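/- Robots are points of $\mathbb{R}^2$. They are anonymous and oblivious, have no common coordinate system, and act in fully synchronous rounds. In each round every robot observes the multiset $C$ of all robot positions in its own local coordinate system (centred at its position, with an arbitrary unit of length, orientation and handedness chosen by an adversary, possibly anew in every round, and shared by robots at the same location). It computes from this observation alone, by an algorithm common to all robots, a probability distribution with finite support on the plane, draws a destination from it independently of the other robots, and moves to that destination. Choosing among $k$ possible destinations costs $\log_2 k$ random bits, and robots that are alone at their location are not counted. A configuration is scattered if no two robots share a location. An algorithm is a scattering algorithm if, for every $n$, from every initial configuration of $n$ robots and for every choice of the local coordinate systems, a scattered configuration is reached with probability $1$. The random bit complexity $R_{\mathcal A}(n)\in[0,\infty]$ of an algorithm $\mathcal A$ is the supremum, over all initial configurations of $n$ robots and all choices of the local coordinate systems, of the expected total number of random bits used by the robots until a scattered configuration is reached. Let $\mathcal A$ be one of the following algorithms, in which the (open) Voronoi cell of a robot at $P$ is the set of points strictly closer to $P$ than to any other occupied location: (i) (Dieudonné–Petit) each robot computes a set of $2$ distinct points in its Voronoi cell and moves to one of them chosen uniformly at random; (ii) (Clément et al.) each robot computes a set of $2|C|^2$ distinct points in its Voronoi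 cell, where $|C|$ is the number of robots, and moves to one of them chosen uniformly at random. Then $\mathcal A$ is a scattering algorithm, robots that are scattered remain scattered, and $\mathcal A$ is random bit optimal: $R_{\mathcal A}(n)=\Theta(n\log n)$, and up to a constant factor no scattering algorithm has a smaller random bit complexity. More precisely, there is an absolute constant $K$ such that, for every such $\mathcal A$ (whatever the choice of the points in the Voronoi cells) and every $n\ge 0$ (with $0\log_2 0=0$), $$n\log_2 n\ \le\ R_{\mathcal A}(n)\ \le\ K\,n\log_2 n ,$$ and $R_{\mathcal A}(n)\le K\,R_{\mathcal B}(n)$ for every scattering algorithm $\mathcal B$. -/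

import Mathlib

open scoped ENNReal NNReal

noncomputable section

namespace Scattering

/-- The plane in which the robots move. -/
abbrev Plane : Type := EuclideanSpace ℝ (Fin 2)

/-- A configuration of `n` robots: the position of every robot. The labels are only used to
describe executions; robots never see them. -/
abbrev Config (n : ℕ) : Type := Fin n → Plane

/-- A configuration is scattered when no two robots share the same location. -/
def Scattered {n : ℕ} (x : Config n) : Prop := Function.Injective x

/-- An ego-centred local coordinate system, up to its origin, which is always the position of the
robot: a unit of length and an orthogonal map (rotation or reflection). -/
structure Frame where
  scale : ℝ
  scale_pos : 0 < scale
  rot : Plane ≃ₗᵢ[ℝ] Plane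

/-- Local coordinates of the point `Q` for a robot located at `P`. -/
def Frame.toLocal (f : Frame) (P Q : Plane) : Plane := f.scale • f.rot (Q - P)

/-- The point with local coordinates `d` for a robot located at `P`. -/
def Frame.toGlobal (f : Frame) (P d : Plane) : Plane := P + f.rot.symm (f.scale⁻¹ • d)

/-- The snapshot taken by a robot at `P`: the multiset of all robot positions in its local
coordinates, where the robot itself is at the origin. -/
def snapshot {n : ℕ} (f : Frame) (P : Plane) (x : Config n) : Multiset Plane :=
  (Finset.univ : Finset (Fin n)).val.map fun j => f.toLocal P (x j)

/-- An oblivious anonymous randomized robot algorithm: from the snapshot (in local coordinates) it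
computes a finitely supported distribution of destinations (in local coordinates). Multiplicities
are visible, so algorithms with a weaker multiplicity detection are particular cases. -/
structure Algorithm where
  dest : Multiset Plane → PMF Plane
  finite_support : ∀ S, (dest S).support.Finite

/-- The joint law of independent random choices with laws `p 0, …, p (n - 1)`. -/
def independent {α : Type} : (n : ℕ) → (Fin n → PMF α) → PMF (Fin n → α)
  | 0, _ => PMF.pure Fin.elim0
  | n + 1, p =>
      (p 0).bind fun a => (independent n fun i => p i.succ).map fun v => Fin.cons a v

/-- The (open) Voronoi cell of `P` in the set of observed positions: the points that are strictly
closer to `P` than to every other observed position. -/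
def voronoiCell (S : Multiset Plane) (P : Plane) : Set Plane :=
  {q | ∀ Q ∈ S, Q ≠ P → dist q P < dist q Q}

namespace Algorithm

/-- The law of the location reached in one Look-Compute-Move cycle by a robot located at `P`. -/
def move {n : ℕ} (A : Algorithm) (f : Frame) (x : Config n) (P : Plane) : PMF Plane :=
  (A.dest (snapshot f P x)).map (f.toGlobal P)

/-- One fully synchronous round. All robots move simultaneously and independently; robots that
share a location share their coordinate system. -/
def step {n : ℕ} (A : Algorithm) (φ : Plane → Frame) (x : Config n) : PMF (Config n) :=
  independent n fun i => A.move (φ (x i)) x (x i)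

open Classical in
/-- The number of random bits used in one round from `x`: choosing among `k` possible destinations
costs `log₂ k` bits, and robots that are alone at their location are not counted. -/
def roundBits {n : ℕ} (A : Algorithm) (φ : Plane → Frame) (x : Config n) : ℝ≥0∞ :=
  ∑ i, if ∃ j, j ≠ i ∧ x j = x i then
      ENNReal.ofReal (Real.logb 2 ((A.dest (snapshot (φ (x i)) (x i) x)).support.ncard))
    else 0

end Algorithm

/-- The adversary selects, at every round and depending on the current configuration, the local
coordinate system in use at each location. -/
abbrev Adversary (n : ℕ) : Type := ℕ → Config n → Plane → Frame

namespace Algorithm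

open Classical in
/-- The law of the configuration after `t` rounds of the execution that starts in `x₀` and is
stopped at the first scattered configuration. -/
def law {n : ℕ} (A : Algorithm) (F : Adversary n) (x₀ : Config n) : ℕ → PMF (Config n)
  | 0 => PMF.pure x₀
  | t + 1 => (law A F x₀ t).bind fun x =>
      if Scattered x then PMF.pure x else A.step (F t x) x

/-- The expected total number of random bits used until the robots are scattered
(no bit is counted in a scattered configuration). -/
def expectedBits {n : ℕ} (A : Algorithm) (F : Adversary n) (x₀ : Config n) : ℝ≥0∞ :=
  ∑' t : ℕ, ∑' x : Config n, A.law F x₀ t x * A.roundBits (F t x) x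

/-- The random bit complexity for `n` robots: the worst case, over all initial configurations and
all choices of coordinate systems, of the expected number of random bits used to scatter. -/
def randomBits (A : Algorithm) (n : ℕ) : ℝ≥0∞ :=
  ⨆ (F : Adversary n) (x₀ : Config n), A.expectedBits F x₀

/-- From every initial configuration, a scattered configuration is reached with probability 1. -/
def IsScattering (A : Algorithm) : Prop :=
  ∀ (n : ℕ) (F : Adversary n) (x₀ : Config n),
    Filter.Tendsto (fun t => (A.law F x₀ t).toOuterMeasure {x | Scattered x})
      Filter.atTop (nhds 1)

/-- Once the robots are scattered, they remain scattered. -/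
def PreservesScattered (A : Algorithm) : Prop :=
  ∀ (n : ℕ) (φ : Plane → Frame) (x : Config n), Scattered x →
    ∀ y ∈ (A.step φ x).support, Scattered y

/-- Each robot computes a set of `k S` distinct points of its own Voronoi cell, where `S` is the
observed configuration, and moves to one of them chosen uniformly at random. -/
def IsVoronoi (A : Algorithm) (k : Multiset Plane → ℕ) : Prop :=
  ∀ S : Multiset Plane, (0 : Plane) ∈ S →
    ∃ (Pos : Finset Plane) (h : Pos.Nonempty), Pos.card = k S ∧
      (∀ q ∈ Pos, q ∈ voronoiCell S 0) ∧ A.dest S = PMF.uniformOfFinset Pos h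

/-- The algorithms of Dieudonné and Petit: two destinations in the Voronoi cell. -/
def IsDieudonnePetit (A : Algorithm) : Prop :=
  A.IsVoronoi fun _ => 2

/-- The algorithms of Clément et al.: `2 |C| ^ 2` destinations in the Voronoi cell, where `|C|` is
the number of robots. -/
def IsClement (A : Algorithm) : Prop :=
  A.IsVoronoi fun S => 2 * Multiset.card S ^ 2

end Algorithm

end Scattering

end

/-! Upper bound. Voronoi cells of distinct locations are disjoint, so robots that are apart never
meet again (`eq_of_step_eq`). Two robots at one location draw the same of `m` points with
probability at most `1/m`, so a pair is still together after `t` rounds with probability at most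
`m⁻ᵗ`, and a given robot is not alone with probability at most `min 1 (n m⁻ᵗ)`. Summed over `t` this
is at most `T + 2` as soon as `n ≤ m ^ T`, so the expected cost is at most `n (log₂ m) (T + 2)`,
which is `O(n log n)` for both algorithms. The bound on `n m⁻ᵗ` also gives scattering with
probability 1.

Lower bound. Let `potential` be the sum over robots of `log₂` of the multiplicity of their location:
it is `n log₂ n` when all robots are gathered and `0` when they are scattered. By Gibbs' inequality
(`sum_logb_card_fiber_le`), a round lowers it by at most the number of bits spent. Telescoping over
the rounds bounds the expected bits of any scattering algorithm from below, which also yields the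
comparison with `B`. -/

noncomputable section

namespace Scattering

/-! ### Expectations with respect to a probability mass function -/

/-- The expectation of a nonnegative function. -/
def expect {α : Type} (p : PMF α) (f : α → ℝ≥0∞) : ℝ≥0∞ := ∑' a, p a * f a

section Expect

variable {α β : Type}

lemma expect_pure (a : α) (f : α → ℝ≥0∞) : expect (PMF.pure a) f = f a := by
  classical
  unfold expect
  rw [tsum_eq_single a]
  · simp
  · intro b hb
    simp [PMF.pure_apply, hb]

lemma expect_bind (p : PMF α) (q : α → PMF β) (f : β → ℝ≥0∞) :
    expect (p.bind q) f = expect p fun a => expect (q a) f := by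
  unfold expect
  simp only [PMF.bind_apply, ← ENNReal.tsum_mul_right, ← ENNReal.tsum_mul_left]
  rw [ENNReal.tsum_comm]
  simp only [mul_assoc]

lemma expect_map (p : PMF α) (g : α → β) (f : β → ℝ≥0∞) :
    expect (p.map g) f = expect p fun a => f (g a) := by
  rw [PMF.map, expect_bind]
  simp only [Function.comp_apply, expect_pure]

lemma expect_mono {p : PMF α} {f g : α → ℝ≥0∞} (h : ∀ a ∈ p.support, f a ≤ g a) :
    expect p f ≤ expect p g := by
  refine ENNReal.tsum_le_tsum fun a => ?_
  by_cases ha : p a = 0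
  · simp [ha]
  · gcongr
    exact h a ((PMF.mem_support_iff p a).2 ha)

lemma expect_const (p : PMF α) (c : ℝ≥0∞) : expect p (fun _ => c) = c := by
  unfold expect
  rw [ENNReal.tsum_mul_right, p.tsum_coe, one_mul]

lemma expect_add (p : PMF α) (f g : α → ℝ≥0∞) :
    expect p (fun a => f a + g a) = expect p f + expect p g := by
  unfold expect
  simp only [mul_add, ENNReal.tsum_add]

lemma expect_mul_left (p : PMF α) (c : ℝ≥0∞) (f : α → ℝ≥0∞) :
    expect p (fun a => c * f a) = c * expect p f := by
  unfold expect
  simp only [← ENNReal.tsum_mul_left]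
  exact tsum_congr fun a => by ring

lemma expect_sum {ι : Type} (p : PMF α) (s : Finset ι) (f : ι → α → ℝ≥0∞) :
    expect p (fun a => ∑ i ∈ s, f i a) = ∑ i ∈ s, expect p (f i) := by
  classical
  induction s using Finset.induction_on with
  | empty => simpa using expect_const p 0
  | insert i s hi ih => simp only [Finset.sum_insert hi, expect_add, ih]

open Classical in
lemma toOuterMeasure_eq_expect (p : PMF α) (s : Set α) :
    p.toOuterMeasure s = expect p fun a => if a ∈ s then 1 else 0 := by
  rw [PMF.toOuterMeasure_apply]
  exact tsum_congr fun a => by by_cases h : a ∈ s <;> simp [h]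

open Classical in
lemma expect_indicator_add_compl (p : PMF α) (P : α → Prop) :
    expect p (fun a => if P a then 1 else 0) + expect p (fun a => if P a then 0 else 1) = 1 := by
  rw [← expect_add]
  refine Eq.trans ?_ (expect_const p 1)
  congr 1
  funext a
  by_cases h : P a <;> simp [h]

lemma map_apply_le_of_injective (p : PMF α) {g : α → β} (hg : g.Injective) {c : ℝ≥0∞}
    (h : ∀ a, p a ≤ c) (b : β) : p.map g b ≤ c := by
  classical
  rw [PMF.map_apply]
  by_cases hb : ∃ a, b = g a
  · obtain ⟨a, rfl⟩ := hb
    rw [tsum_eq_single a]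
    · simpa using h a
    · intro a' ha'
      rw [if_neg fun e => ha' (hg e).symm]
  · push Not at hb
    simp [hb]

end Expect

/-! ### Independent choices -/

section Independent

variable {α : Type}

lemma mem_support_independent {n : ℕ} {p : Fin n → PMF α} {v : Fin n → α}
    (hv : v ∈ (independent n p).support) (i : Fin n) : v i ∈ (p i).support := by
  induction n with
  | zero => exact i.elim0
  | succ n ih =>
    rw [independent, PMF.mem_support_bind_iff] at hv
    obtain ⟨a, ha, hv⟩ := hv
    rw [PMF.mem_support_map_iff] at hv
    obtain ⟨w, hw, rfl⟩ := hv
    refine Fin.cases ?_ (fun i => ?_) i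
    · simpa using ha
    · simpa using ih hw i

lemma expect_independent_apply {n : ℕ} (p : Fin n → PMF α) (i : Fin n) (f : α → ℝ≥0∞) :
    expect (independent n p) (fun v => f (v i)) = expect (p i) f := by
  induction n with
  | zero => exact i.elim0
  | succ n ih =>
    rw [independent, expect_bind]
    simp only [expect_map]
    refine Fin.cases ?_ (fun i => ?_) i
    · simp only [Fin.cons_zero, expect_const]
    · simp only [Fin.cons_succ, ih (fun i => p i.succ) i, expect_const]

lemma expect_eq_point [DecidableEq α] (p : PMF α) (a : α) :
    expect p (fun b => if b = a then 1 else 0) = p a := by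
  unfold expect
  rw [tsum_eq_single a]
  · simp
  · intro b hb
    simp [hb]

/-- Once one of the two draws is fixed, the other has to hit that value. The induction peels off
coordinates until coordinate `0` is one of the two. -/
lemma expect_independent_collision_le [DecidableEq α] {n : ℕ} (p : Fin n → PMF α) {c : ℝ≥0∞}
    {i j : Fin n} (hij : i ≠ j) (hi : ∀ a, p i a ≤ c) (hj : ∀ a, p j a ≤ c) :
    expect (independent n p) (fun v => if v i = v j then 1 else 0) ≤ c := by
  induction n with
  | zero => exact i.elim0
  | succ n ih =>
    rw [independent, expect_bind]
    simp only [expect_map]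
    rw [← expect_const (p 0) c]
    refine expect_mono fun a _ => ?_
    rcases Fin.eq_zero_or_eq_succ i with rfl | ⟨i, rfl⟩ <;>
      rcases Fin.eq_zero_or_eq_succ j with rfl | ⟨j, rfl⟩
    · exact absurd rfl hij
    · simp only [Fin.cons_zero, Fin.cons_succ, eq_comm (a := a)]
      rw [expect_independent_apply (fun i => p i.succ) j fun b => if b = a then 1 else 0,
        expect_eq_point]
      exact hj a
    · simp only [Fin.cons_zero, Fin.cons_succ]
      rw [expect_independent_apply (fun i => p i.succ) i fun b => if b = a then 1 else 0,
        expect_eq_point]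
      exact hi a
    · simp only [Fin.cons_succ]
      exact ih _ (fun e => hij (congrArg _ e)) hi hj

end Independent

/-! ### Coordinates and Voronoi cells -/

lemma Frame.toGlobal_injective (f : Frame) (P : Plane) : (f.toGlobal P).Injective := by
  intro d e h
  have h' := f.rot.symm.injective (add_left_cancel h)
  exact smul_right_injective _ (inv_ne_zero f.scale_pos.ne') h'

/-- Local coordinates are a similarity, so comparisons of distances, hence Voronoi cells, do not
depend on the frame. -/
lemma Frame.dist_toLocal (f : Frame) (P d Q : Plane) :
    dist d (f.toLocal P Q) = f.scale * dist (f.toGlobal P d) Q := by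
  have h : d - f.toLocal P Q = f.scale • f.rot (f.toGlobal P d - Q) := by
    have e : f.toGlobal P d - Q = f.rot.symm (f.scale⁻¹ • d) - (Q - P) := by
      rw [Frame.toGlobal]; abel
    rw [e, map_sub, LinearIsometryEquiv.apply_symm_apply, smul_sub,
      smul_inv_smul₀ f.scale_pos.ne', Frame.toLocal]
  rw [dist_eq_norm, h, norm_smul, LinearIsometryEquiv.norm_map, dist_eq_norm,
    Real.norm_of_nonneg f.scale_pos.le]

lemma Frame.toLocal_self (f : Frame) (P : Plane) : f.toLocal P P = 0 := by
  simp [Frame.toLocal]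

lemma Frame.toLocal_eq_zero (f : Frame) {P Q : Plane} : f.toLocal P Q = 0 ↔ Q = P := by
  simp [Frame.toLocal, f.scale_pos.ne', sub_eq_zero]

lemma toLocal_mem_snapshot {n : ℕ} (f : Frame) (P : Plane) (x : Config n) (j : Fin n) :
    f.toLocal P (x j) ∈ snapshot f P x :=
  Multiset.mem_map.2 ⟨j, Finset.mem_univ j, rfl⟩

lemma zero_mem_snapshot {n : ℕ} (f : Frame) (x : Config n) (i : Fin n) :
    0 ∈ snapshot f (x i) x := by
  simpa [Frame.toLocal_self] using toLocal_mem_snapshot f (x i) x i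

lemma card_snapshot {n : ℕ} (f : Frame) (P : Plane) (x : Config n) :
    (snapshot f P x).card = n := by
  simp [snapshot]

lemma dist_toGlobal_lt_of_mem_voronoiCell {n : ℕ} {f : Frame} {x : Config n} {P d : Plane}
    (hd : d ∈ voronoiCell (snapshot f P x) 0) {j : Fin n} (hj : x j ≠ P) :
    dist (f.toGlobal P d) P < dist (f.toGlobal P d) (x j) := by
  have h := hd _ (toLocal_mem_snapshot f P x j) (mt f.toLocal_eq_zero.1 hj)
  rw [← f.toLocal_self P, f.dist_toLocal, f.dist_toLocal] at h
  exact lt_of_mul_lt_mul_left h f.scale_pos.le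

/-! ### One round of a Voronoi algorithm -/

namespace Algorithm

variable {A : Algorithm} {k : Multiset Plane → ℕ} {n : ℕ}

lemma IsVoronoi.dist_lt_of_mem_support (hA : A.IsVoronoi k) {φ : Plane → Frame} {x y : Config n}
    (hy : y ∈ (A.step φ x).support) {i j : Fin n} (hij : x j ≠ x i) :
    dist (y i) (x i) < dist (y i) (x j) := by
  have hi := mem_support_independent hy i
  rw [move, PMF.mem_support_map_iff] at hi
  obtain ⟨d, hd, e⟩ := hi
  obtain ⟨Pos, hne, -, hcell, hdest⟩ := hA _ (zero_mem_snapshot (φ (x i)) x i)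
  rw [hdest, PMF.mem_support_uniformOfFinset_iff] at hd
  rw [← e]
  exact dist_toGlobal_lt_of_mem_voronoiCell (hcell d hd) hij

/-- A common destination of robots from two locations would be strictly closer to each location than
to the other. -/
lemma IsVoronoi.eq_of_step_eq (hA : A.IsVoronoi k) {φ : Plane → Frame} {x y : Config n}
    (hy : y ∈ (A.step φ x).support) {i j : Fin n} (hij : y i = y j) : x i = x j := by
  by_contra h
  have h₁ := hA.dist_lt_of_mem_support hy (Ne.symm h)
  have h₂ := hA.dist_lt_of_mem_support hy h
  rw [hij] at h₁
  exact lt_asymm h₁ h₂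

lemma IsVoronoi.preservesScattered (hA : A.IsVoronoi k) : A.PreservesScattered :=
  fun _ _ _ hx _ hy _ _ hij => hx (hA.eq_of_step_eq hy hij)

/-- The hypothesis `hk` covers both algorithms: every snapshot of `n` robots has cardinality `n`, so
the number of choices is a constant `m` once `n` is fixed. -/
lemma IsVoronoi.move_apply_le (hA : A.IsVoronoi k) {m : ℕ}
    (hk : ∀ S : Multiset Plane, S.card = n → k S = m) (f : Frame) (x : Config n) (i : Fin n)
    (a : Plane) : A.move f x (x i) a ≤ (m : ℝ≥0∞)⁻¹ := by
  classical
  refine map_apply_le_of_injective _ (f.toGlobal_injective _) (fun d => ?_) a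
  obtain ⟨Pos, hne, hcard, -, hdest⟩ := hA _ (zero_mem_snapshot f x i)
  rw [hdest, PMF.uniformOfFinset_apply, hcard, hk _ (card_snapshot _ _ _)]
  split_ifs <;> simp

open Classical in
-- The indicator on the right encodes that separated robots stay separated; it makes the bound
-- iterate to a power of `m⁻¹`.
lemma IsVoronoi.expect_step_collision_le (hA : A.IsVoronoi k) {m : ℕ}
    (hk : ∀ S : Multiset Plane, S.card = n → k S = m) (φ : Plane → Frame) (x : Config n)
    {i j : Fin n} (hij : i ≠ j) :
    expect (A.step φ x) (fun y => if y i = y j then 1 else 0) ≤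
      (m : ℝ≥0∞)⁻¹ * if x i = x j then 1 else 0 := by
  split_ifs with h
  · rw [mul_one]
    exact expect_independent_collision_le (fun i => A.move (φ (x i)) x (x i)) hij
      (hA.move_apply_le hk _ x i) (hA.move_apply_le hk _ x j)
  · rw [mul_zero]
    refine le_trans (expect_mono fun y hy => ?_) (expect_const (A.step φ x) 0).le
    rw [if_neg fun e => h (hA.eq_of_step_eq hy e)]

/-- The bits used in a round, when all robots choose among `m` destinations. -/
lemma IsVoronoi.roundBits_eq (hA : A.IsVoronoi k) {m : ℕ}
    (hk : ∀ S : Multiset Plane, S.card = n → k S = m) (φ : Plane → Frame) (x : Config n) :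
    A.roundBits φ x = ∑ i, open Classical in
      if ∃ j, j ≠ i ∧ x j = x i then ENNReal.ofReal (Real.logb 2 m) else 0 := by
  classical
  unfold roundBits
  refine Finset.sum_congr rfl fun i _ => ?_
  obtain ⟨Pos, hne, hcard, -, hdest⟩ := hA _ (zero_mem_snapshot (φ (x i)) x i)
  rw [hdest, PMF.support_uniformOfFinset, Set.ncard_coe_finset, hcard, hk _ (card_snapshot _ _ _)]

open Classical in
/-- Two robots are at the same location after `t` rounds with probability at most `m⁻ᵗ`. -/
lemma IsVoronoi.expect_law_collision_le (hA : A.IsVoronoi k) {m : ℕ}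
    (hk : ∀ S : Multiset Plane, S.card = n → k S = m) (F : Adversary n) (x₀ : Config n)
    {i j : Fin n} (hij : i ≠ j) (t : ℕ) :
    expect (A.law F x₀ t) (fun y => if y i = y j then 1 else 0) ≤ (m : ℝ≥0∞)⁻¹ ^ t := by
  induction t with
  | zero =>
    rw [law, expect_pure]
    split_ifs <;> simp
  | succ t ih =>
    rw [law, expect_bind, pow_succ']
    calc _ ≤ expect (A.law F x₀ t) fun x => (m : ℝ≥0∞)⁻¹ * if x i = x j then 1 else 0 := by
          refine expect_mono fun x _ => ?_
          split_ifs with hx h h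
          · exact absurd (hx h) hij
          · simp [expect_pure, h]
          · simpa [h] using hA.expect_step_collision_le hk (F t x) x hij
          · simpa [h] using hA.expect_step_collision_le hk (F t x) x hij
      _ ≤ _ := by
          rw [expect_mul_left]
          gcongr

open Classical in
/-- A robot is not alone after `t` rounds with probability at most `n m⁻ᵗ`. -/
lemma IsVoronoi.expect_law_not_alone_le (hA : A.IsVoronoi k) {m : ℕ}
    (hk : ∀ S : Multiset Plane, S.card = n → k S = m) (F : Adversary n) (x₀ : Config n)
    (i : Fin n) (t : ℕ) :
    expect (A.law F x₀ t) (fun y => if ∃ j, j ≠ i ∧ y j = y i then 1 else 0) ≤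
      n * (m : ℝ≥0∞)⁻¹ ^ t := by
  calc _ ≤ expect (A.law F x₀ t) fun y =>
        ∑ j ∈ Finset.univ.filter (· ≠ i), if y j = y i then 1 else 0 := by
        refine expect_mono fun y _ => ?_
        split_ifs with h
        · obtain ⟨j, hj, e⟩ := h
          refine le_trans ?_ (Finset.single_le_sum (fun _ _ => zero_le)
            (Finset.mem_filter.2 ⟨Finset.mem_univ j, hj⟩))
          simp [e]
        · exact zero_le
    _ ≤ ∑ _j ∈ Finset.univ.filter (· ≠ i), (m : ℝ≥0∞)⁻¹ ^ t := by
        rw [expect_sum]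
        exact Finset.sum_le_sum fun j hj =>
          hA.expect_law_collision_le hk F x₀ (Finset.mem_filter.1 hj).2 t
    _ ≤ _ := by
        rw [Finset.sum_const, nsmul_eq_mul]
        gcongr
        exact (Finset.card_le_univ _).trans_eq (Fintype.card_fin n)

/-! ### Voronoi algorithms scatter -/

open Classical in
lemma IsVoronoi.expect_law_not_scattered_le (hA : A.IsVoronoi k) {m : ℕ}
    (hk : ∀ S : Multiset Plane, S.card = n → k S = m) (F : Adversary n) (x₀ : Config n) (t : ℕ) :
    expect (A.law F x₀ t) (fun y => if Scattered y then 0 else 1) ≤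
      n * (n * (m : ℝ≥0∞)⁻¹ ^ t) := by
  calc _ ≤ expect (A.law F x₀ t) fun y =>
        ∑ i, if ∃ j, j ≠ i ∧ y j = y i then 1 else 0 := by
        refine expect_mono fun y _ => ?_
        split_ifs with h
        · exact zero_le
        · simp only [Scattered, Function.Injective, not_forall] at h
          obtain ⟨j, i, e, hj⟩ := h
          refine le_trans ?_ (Finset.single_le_sum (fun _ _ => zero_le) (Finset.mem_univ i))
          rw [if_pos ⟨j, hj, e⟩]
    _ ≤ ∑ _i : Fin n, n * (m : ℝ≥0∞)⁻¹ ^ t := by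
        rw [expect_sum]
        exact Finset.sum_le_sum fun i _ => hA.expect_law_not_alone_le hk F x₀ i t
    _ = _ := by simp

open Classical in
lemma toOuterMeasure_scattered_add (p : PMF (Config n)) :
    p.toOuterMeasure {x | Scattered x} + expect p (fun y => if Scattered y then 0 else 1) = 1 := by
  rw [toOuterMeasure_eq_expect]
  exact expect_indicator_add_compl p Scattered

lemma IsVoronoi.isScattering (hA : A.IsVoronoi k)
    -- For `n = 0` the second algorithm has `m = 0`, so `2 ≤ m` can only be asked for positive `n`.
    (hk : ∀ n, ∃ m, (0 < n → 2 ≤ m) ∧ ∀ S : Multiset Plane, S.card = n → k S = m) :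
    A.IsScattering := by
  classical
  intro n F x₀
  obtain ⟨m, hm, hk⟩ := hk n
  have h0 : Filter.Tendsto (fun t => (n : ℝ≥0∞) * (n * (m : ℝ≥0∞)⁻¹ ^ t)) Filter.atTop (nhds 0) := by
    rcases Nat.eq_zero_or_pos n with rfl | hn
    · simp
    have hm1 : (m : ℝ≥0∞)⁻¹ < 1 := by
      rw [ENNReal.inv_lt_one]
      exact_mod_cast hm hn
    have := ENNReal.tendsto_pow_atTop_nhds_zero_of_lt_one hm1
    have h1 := ENNReal.Tendsto.const_mul this (Or.inr (ENNReal.natCast_ne_top n))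
    have h2 := ENNReal.Tendsto.const_mul h1 (Or.inr (ENNReal.natCast_ne_top n))
    simpa using h2
  have h1 : Filter.Tendsto (fun t => 1 - (n : ℝ≥0∞) * (n * (m : ℝ≥0∞)⁻¹ ^ t)) Filter.atTop
      (nhds 1) := by
    simpa using ENNReal.Tendsto.sub tendsto_const_nhds h0 (Or.inl ENNReal.one_ne_top)
  refine tendsto_of_tendsto_of_tendsto_of_le_of_le h1 tendsto_const_nhds (fun t => ?_) fun t => ?_
  · have h := toOuterMeasure_scattered_add (A.law F x₀ t)
    rw [tsub_le_iff_right]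
    rw [← h]
    gcongr
    exact hA.expect_law_not_scattered_le hk F x₀ t
  · rw [← toOuterMeasure_scattered_add (A.law F x₀ t)]
    exact le_self_add

/-! ### Upper bound -/

/-- The first `T` terms are at most `1`; from `T` on, `n m⁻ᵀ ≤ 1` leaves a geometric tail of ratio
at most `1/2` and sum at most `2`. -/
lemma tsum_min_one_geometric_le {m T : ℕ} (hm : 2 ≤ m) (hT : n ≤ m ^ T) :
    ∑' t : ℕ, min 1 ((n : ℝ≥0∞) * (m : ℝ≥0∞)⁻¹ ^ t) ≤ T + 2 := by
  have head : ∑ t ∈ Finset.range T, min 1 ((n : ℝ≥0∞) * (m : ℝ≥0∞)⁻¹ ^ t) ≤ T := by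
    calc _ ≤ ∑ _t ∈ Finset.range T, (1 : ℝ≥0∞) := Finset.sum_le_sum fun _ _ => min_le_left _ _
      _ = T := by simp
  have h : (n : ℝ≥0∞) * (m : ℝ≥0∞)⁻¹ ^ T ≤ 1 := by
    rw [← ENNReal.inv_pow, ← div_eq_mul_inv]
    exact ENNReal.div_le_of_le_mul (by rw [one_mul]; exact_mod_cast hT)
  have hm2 : (m : ℝ≥0∞)⁻¹ ≤ 2⁻¹ := ENNReal.inv_le_inv.2 (by exact_mod_cast hm)
  have tail : ∀ t, min 1 ((n : ℝ≥0∞) * (m : ℝ≥0∞)⁻¹ ^ (t + T)) ≤ (2 : ℝ≥0∞)⁻¹ ^ t := by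
    intro t
    calc _ ≤ (n : ℝ≥0∞) * (m : ℝ≥0∞)⁻¹ ^ (t + T) := min_le_right _ _
      _ = (n * (m : ℝ≥0∞)⁻¹ ^ T) * (m : ℝ≥0∞)⁻¹ ^ t := by rw [pow_add]; ring
      _ ≤ 1 * (2 : ℝ≥0∞)⁻¹ ^ t := mul_le_mul' h (pow_le_pow_left' hm2 t)
      _ = _ := one_mul _
  have h2 : ∑' t : ℕ, (2 : ℝ≥0∞)⁻¹ ^ t = 2 := by
    rw [ENNReal.tsum_geometric, ENNReal.one_sub_inv_two, inv_inv]
  have split := Summable.sum_add_tsum_nat_add' (k := T)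
    (f := fun t : ℕ => min 1 ((n : ℝ≥0∞) * (m : ℝ≥0∞)⁻¹ ^ t)) ENNReal.summable
  calc _ = _ := split.symm
    _ ≤ (T : ℝ≥0∞) + ∑' t : ℕ, (2 : ℝ≥0∞)⁻¹ ^ t :=
        add_le_add head (ENNReal.tsum_le_tsum tail)
    _ = _ := by rw [h2]

lemma IsVoronoi.expectedBits_le (hA : A.IsVoronoi k) {m T : ℕ} (hm : 2 ≤ m) (hT : n ≤ m ^ T)
    (hk : ∀ S : Multiset Plane, S.card = n → k S = m) (F : Adversary n) (x₀ : Config n) :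
    A.expectedBits F x₀ ≤ n * ENNReal.ofReal (Real.logb 2 m) * (T + 2) := by
  classical
  calc A.expectedBits F x₀
      = ∑' t, expect (A.law F x₀ t) fun x => A.roundBits (F t x) x := rfl
    _ ≤ ∑' t : ℕ, n * ENNReal.ofReal (Real.logb 2 m) *
          min 1 ((n : ℝ≥0∞) * (m : ℝ≥0∞)⁻¹ ^ t) := by
        refine ENNReal.tsum_le_tsum fun t => ?_
        have h : ∀ i : Fin n, expect (A.law F x₀ t)
            (fun y => if ∃ j, j ≠ i ∧ y j = y i then ENNReal.ofReal (Real.logb 2 m) else 0) ≤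
            ENNReal.ofReal (Real.logb 2 m) * min 1 ((n : ℝ≥0∞) * (m : ℝ≥0∞)⁻¹ ^ t) := by
          intro i
          have e : ∀ y : Config n,
              (if ∃ j, j ≠ i ∧ y j = y i then ENNReal.ofReal (Real.logb 2 m) else 0) =
              ENNReal.ofReal (Real.logb 2 m) * if ∃ j, j ≠ i ∧ y j = y i then 1 else 0 :=
            fun y => by split_ifs <;> simp
          simp only [e, expect_mul_left]
          gcongr
          refine le_min ?_ (hA.expect_law_not_alone_le hk F x₀ i t)
          refine le_trans (expect_mono fun y _ => ?_) (expect_const (A.law F x₀ t) 1).le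
          split_ifs <;> simp
        simp only [hA.roundBits_eq hk, expect_sum]
        calc _ ≤ ∑ _i : Fin n, _ := Finset.sum_le_sum fun i _ => h i
          _ = _ := by
            rw [Finset.sum_const, Finset.card_univ, Fintype.card_fin, nsmul_eq_mul, mul_assoc]
    _ ≤ _ := by
        rw [ENNReal.tsum_mul_left]
        gcongr
        exact tsum_min_one_geometric_le hm hT

lemma randomBits_eq_zero (hn : n ≤ 1) : A.randomBits n = 0 := by
  classical
  have : Subsingleton (Fin n) := Fin.subsingleton_iff_le_one.2 hn
  have h : ∀ φ (x : Config n), A.roundBits φ x = 0 := by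
    intro φ x
    refine Finset.sum_eq_zero fun i _ => if_neg ?_
    rintro ⟨j, hj, -⟩
    exact hj (Subsingleton.elim j i)
  simp [randomBits, expectedBits, h]

lemma IsVoronoi.randomBits_le (hA : A.IsVoronoi k) {m T : ℕ} (hm : 2 ≤ m) (hT : n ≤ m ^ T)
    (hk : ∀ S : Multiset Plane, S.card = n → k S = m) {c : ℝ≥0}
    (hc : Real.logb 2 m * (T + 2) ≤ c * Real.logb 2 n) :
    A.randomBits n ≤ c * ENNReal.ofReal (n * Real.logb 2 n) := by
  refine iSup₂_le fun F x₀ => (hA.expectedBits_le hm hT hk F x₀).trans ?_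
  have hT : ((T : ℝ≥0∞) + 2) = ENNReal.ofReal (T + 2) := by
    rw [ENNReal.ofReal_add (by positivity) (by positivity), ENNReal.ofReal_natCast,
      ENNReal.ofReal_ofNat]
  rw [mul_assoc, hT, ← ENNReal.ofReal_mul' (by positivity), ENNReal.ofReal_mul (Nat.cast_nonneg n),
    ENNReal.ofReal_natCast, mul_left_comm, ← ENNReal.ofReal_coe_nnreal (p := c),
    ← ENNReal.ofReal_mul c.coe_nonneg]
  gcongr

lemma one_le_logb_natCast (hn : 2 ≤ n) : 1 ≤ Real.logb 2 n := by
  rw [Real.le_logb_iff_rpow_le one_lt_two (by positivity), Real.rpow_one]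
  exact_mod_cast hn

lemma IsDieudonnePetit.randomBits_le (hA : A.IsDieudonnePetit) (n : ℕ) :
    A.randomBits n ≤ (9 : ℝ≥0) * ENNReal.ofReal (n * Real.logb 2 n) := by
  rcases Nat.lt_or_ge n 2 with hn | hn
  · rw [randomBits_eq_zero (by omega)]
    exact zero_le
  -- Here `T = ⌈log₂ n⌉`, and with `L = log₂ n ≥ 1` the cost factor `T + 2` is at most `L + 3 ≤ 4L`.
  refine IsVoronoi.randomBits_le hA le_rfl (Nat.le_pow_clog one_lt_two n) (fun _ _ => rfl) ?_
  have hL := one_le_logb_natCast hn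
  have hT : (Nat.clog 2 n : ℝ) ≤ Real.logb 2 n + 1 := by
    have h := (Nat.ceil_lt_add_one (zero_le_one.trans hL)).le
    have e := Real.natCeil_logb_natCast 2 n
    push_cast at e
    rwa [e] at h
  have h2 : Real.logb 2 ((2 : ℕ) : ℝ) = 1 := by
    push_cast
    exact Real.logb_self_eq_one one_lt_two
  rw [h2]
  push_cast
  linarith

lemma IsClement.randomBits_le (hA : A.IsClement) (n : ℕ) :
    A.randomBits n ≤ (9 : ℝ≥0) * ENNReal.ofReal (n * Real.logb 2 n) := by
  rcases Nat.lt_or_ge n 2 with hn | hn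
  · rw [randomBits_eq_zero (by omega)]
    exact zero_le
  -- One round suffices for `n ≤ m ^ T`. With `L = log₂ n ≥ 1` the cost factor is `3 (1 + 2L) ≤ 9L`,
  -- the origin of the constant 9.
  refine IsVoronoi.randomBits_le hA (m := 2 * n ^ 2) (T := 1) (by nlinarith) (by nlinarith)
    (fun S hS => by simp only [hS]) ?_
  have hL := one_le_logb_natCast hn
  have hm : Real.logb 2 ((2 * n ^ 2 : ℕ) : ℝ) = 1 + 2 * Real.logb 2 n := by
    push_cast
    rw [Real.logb_mul two_ne_zero (by positivity), Real.logb_self_eq_one one_lt_two,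
      Real.logb_pow]
    norm_num
  rw [hm]
  push_cast
  linarith

lemma IsDieudonnePetit.isScattering (hA : A.IsDieudonnePetit) : A.IsScattering :=
  IsVoronoi.isScattering hA fun _ => ⟨2, fun _ => le_rfl, fun _ _ => rfl⟩

lemma IsClement.isScattering (hA : A.IsClement) : A.IsScattering :=
  IsVoronoi.isScattering hA fun n =>
    ⟨2 * n ^ 2, fun hn => by nlinarith, fun S hS => by simp only [hS]⟩

end Algorithm

/-! ### Lower bound -/

section Counting

variable {ι α β : Type} [DecidableEq α] [DecidableEq β]

/-- Each nonempty fiber contributes exactly `1`. -/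
lemma sum_inv_card_fiber (G : Finset ι) (f : ι → α) :
    ∑ i ∈ G, ((G.filter fun j => f j = f i).card : ℝ)⁻¹ = (G.image f).card := by
  rw [← Finset.sum_fiberwise_of_maps_to fun i hi => Finset.mem_image_of_mem f hi,
    Finset.card_eq_sum_ones, Nat.cast_sum]
  refine Finset.sum_congr rfl fun a ha => ?_
  obtain ⟨i, hi, rfl⟩ := Finset.mem_image.1 ha
  have h : ∀ l ∈ G.filter fun j => f j = f i, ((G.filter fun j => f j = f l).card : ℝ)⁻¹ =
      ((G.filter fun j => f j = f i).card : ℝ)⁻¹ := by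
    intro l hl
    rw [(Finset.mem_filter.1 hl).2]
  rw [Finset.sum_congr rfl h, Finset.sum_const, nsmul_eq_mul, Nat.cast_one]
  refine mul_inv_cancel₀ (Nat.cast_ne_zero.2 (Finset.card_ne_zero.2 ⟨i, ?_⟩))
  exact Finset.mem_filter.2 ⟨hi, rfl⟩

variable [Fintype ι]

/-- If the fibers of `x` are split by `y` into at most `s` parts, then the sum over all points of
the logarithm of the size of the fiber drops by at most the sum of the logarithms of `s`. -/
lemma sum_logb_card_fiber_le (x : ι → α) (y : ι → β) (s : α → ℕ)
    (hs : ∀ P, ((Finset.univ.filter fun j => x j = P).image y).card ≤ s P) :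
    ∑ i, Real.logb 2 (Finset.univ.filter fun j => x j = x i).card ≤
      ∑ i, Real.logb 2 (s (x i)) + ∑ i, Real.logb 2 (Finset.univ.filter fun j => y j = y i).card := by
  set G : α → Finset ι := fun P => Finset.univ.filter fun j => x j = P with hG
  set c : ι → ℕ := fun i => ((G (x i)).filter fun j => y j = y i).card with hc
  have mem (i : ι) : i ∈ G (x i) := by simp [hG]
  have hc0 (i : ι) : 0 < c i :=
    Finset.card_pos.2 ⟨i, Finset.mem_filter.2 ⟨mem i, rfl⟩⟩
  have hm0 (i : ι) : 0 < (G (x i)).card := Finset.card_pos.2 ⟨i, mem i⟩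
  have hs0 (i : ι) : 0 < s (x i) :=
    (Finset.card_pos.2 ((Finset.image_nonempty (f := y)).2 ⟨i, mem i⟩)).trans_le (hs _)
  -- `c i` counts only those companions of `i` that shared its fiber of `x`. Merging with other
  -- fibers can only enlarge the fiber of `y`.
  have hcy (i : ι) :
      Real.logb 2 (c i) ≤ Real.logb 2 (Finset.univ.filter fun j => y j = y i).card := by
    refine Real.logb_le_logb_of_le one_lt_two (by exact_mod_cast hc0 i) ?_
    exact_mod_cast Finset.card_le_card (Finset.filter_subset_filter _ (Finset.subset_univ _))
  -- This is `log u ≤ u - 1` for `u = |G| / (s c)`; `hsum` then shows that the values of `u` average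
  -- to at most `1`.
  have hterm (i : ι) : Real.log (G (x i)).card - Real.log (s (x i)) - Real.log (c i) ≤
      ((G (x i)).card : ℝ) / s (x i) * (c i : ℝ)⁻¹ - 1 := by
    have h1 : ((G (x i)).card : ℝ) ≠ 0 := by exact_mod_cast (hm0 i).ne'
    have h2 : (s (x i) : ℝ) ≠ 0 := by exact_mod_cast (hs0 i).ne'
    have h3 : (c i : ℝ) ≠ 0 := by exact_mod_cast (hc0 i).ne'
    rw [← Real.log_div h1 h2, ← Real.log_div (div_ne_zero h1 h2) h3, div_eq_mul_inv _ (c i : ℝ)]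
    refine Real.log_le_sub_one_of_pos ?_
    have := hm0 i; have := hs0 i; have := hc0 i
    positivity
  have hsum : ∑ i, ((G (x i)).card : ℝ) / s (x i) * (c i : ℝ)⁻¹ ≤ ∑ _i : ι, 1 := by
    have maps : ∀ i ∈ (Finset.univ : Finset ι), x i ∈ Finset.univ.image x :=
      fun i hi => Finset.mem_image_of_mem x hi
    rw [← Finset.sum_fiberwise_of_maps_to maps, ← Finset.sum_fiberwise_of_maps_to maps]
    refine Finset.sum_le_sum fun P hP => ?_
    obtain ⟨i₀, -, rfl⟩ := Finset.mem_image.1 hP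
    change ∑ i ∈ G (x i₀), _ ≤ ∑ i ∈ G (x i₀), _
    have e : ∀ i ∈ G (x i₀), ((G (x i)).card : ℝ) / s (x i) * (c i : ℝ)⁻¹ =
        ((G (x i₀)).card : ℝ) / s (x i₀) * (((G (x i₀)).filter fun j => y j = y i).card : ℝ)⁻¹ := by
      intro i hi
      simp only [hc]
      rw [(Finset.mem_filter.1 hi).2]
    have hpos : (0 : ℝ) < s (x i₀) := by exact_mod_cast hs0 i₀
    -- Over one fiber the sum is `|G| / s` times the number of parts, and there are at most `s`
    -- parts.
    rw [Finset.sum_congr rfl e, ← Finset.mul_sum, sum_inv_card_fiber, Finset.sum_const,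
      nsmul_eq_mul, mul_one, div_mul_eq_mul_div, div_le_iff₀ hpos]
    gcongr
    exact hs _
  have hln : ∑ i, Real.log (G (x i)).card ≤ ∑ i, Real.log (s (x i)) + ∑ i, Real.log (c i) := by
    have h := Finset.sum_le_sum fun i (_ : i ∈ Finset.univ) => hterm i
    simp only [Finset.sum_sub_distrib] at h
    linarith
  calc _ ≤ ∑ i, Real.logb 2 (s (x i)) + ∑ i, Real.logb 2 (c i) := by
        simp only [Real.logb, ← Finset.sum_div, ← add_div]
        exact div_le_div_of_nonneg_right hln (Real.log_pos one_lt_two).le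
    _ ≤ _ := add_le_add le_rfl (Finset.sum_le_sum fun i _ => hcy i)

end Counting

open Classical in
/-- The sum over all robots of the logarithm of the multiplicity of their location. -/
def potential {n : ℕ} (x : Config n) : ℝ≥0∞ :=
  ENNReal.ofReal (∑ i, Real.logb 2 (Finset.univ.filter fun j => x j = x i).card)

section Potential

variable {n : ℕ}

lemma logb_natCast_nonneg (m : ℕ) : 0 ≤ Real.logb 2 m := by
  rcases Nat.eq_zero_or_pos m with rfl | hm
  · simp
  · exact Real.logb_nonneg one_lt_two (by exact_mod_cast hm)

lemma potential_eq_zero {x : Config n} (hx : Scattered x) : potential x = 0 := by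
  classical
  have h (i : Fin n) : (Finset.univ.filter fun j => x j = x i) = {i} := by
    ext j
    simp [hx.eq_iff]
  simp [potential, h]

lemma potential_const (P : Plane) :
    potential (fun _ : Fin n => P) = ENNReal.ofReal (n * Real.logb 2 n) := by
  simp [potential]

lemma potential_le (x : Config n) : potential x ≤ ENNReal.ofReal (n * Real.logb 2 n) := by
  classical
  refine ENNReal.ofReal_le_ofReal ?_
  calc _ ≤ ∑ _i : Fin n, Real.logb 2 n := by
        refine Finset.sum_le_sum fun i _ => Real.logb_le_logb_of_le one_lt_two ?_ ?_
        · exact_mod_cast Finset.card_pos.2 ⟨i, by simp⟩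
        · exact_mod_cast (Finset.card_le_univ _).trans_eq (Fintype.card_fin n)
    _ = _ := by simp

namespace Algorithm

/-- A round decreases the potential by at most the number of random bits that are used. -/
lemma potential_le_roundBits_add (A : Algorithm) (φ : Plane → Frame) {x y : Config n}
    (hy : y ∈ (A.step φ x).support) : potential x ≤ A.roundBits φ x + potential y := by
  classical
  -- A lone robot is not charged and cannot be split, so its location gets `s = 1`, whose logarithm
  -- vanishes.
  set s : Plane → ℕ := fun P =>
    if 2 ≤ (Finset.univ.filter fun j => x j = P).card then
      (A.dest (snapshot (φ P) P x)).support.ncard else 1 with hs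
  have hbits : A.roundBits φ x = ENNReal.ofReal (∑ i, Real.logb 2 (s (x i))) := by
    rw [ENNReal.ofReal_sum_of_nonneg fun i _ => logb_natCast_nonneg _]
    refine Finset.sum_congr rfl fun i _ => ?_
    have h : (∃ j, j ≠ i ∧ x j = x i) ↔ 2 ≤ (Finset.univ.filter fun j => x j = x i).card := by
      rw [← Nat.lt_iff_add_one_le, Finset.one_lt_card_iff_nontrivial]
      constructor
      · rintro ⟨j, hj, e⟩
        exact ⟨j, by simpa using e, i, by simp, hj⟩
      · intro hnt
        obtain ⟨j, hj, hne⟩ := hnt.exists_ne i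
        exact ⟨j, hne, by simpa using hj⟩
    simp only [h, hs]
    split_ifs <;> simp
  rw [hbits, potential, potential, ← ENNReal.ofReal_add
    (Finset.sum_nonneg fun i _ => logb_natCast_nonneg _)
    (Finset.sum_nonneg fun i _ => logb_natCast_nonneg _)]
  refine ENNReal.ofReal_le_ofReal (sum_logb_card_fiber_le x y s fun P => ?_)
  simp only [hs]
  split_ifs with h
  -- Robots at `P` share their frame, hence draw from one common support. Its finiteness matters
  -- because `ncard` is `0` on infinite sets.
  · have hfin := (A.finite_support (snapshot (φ P) P x)).image ((φ P).toGlobal P)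
    calc _ = (((Finset.univ.filter fun j => x j = P).image y : Finset Plane) : Set Plane).ncard :=
          (Set.ncard_coe_finset _).symm
      _ ≤ ((φ P).toGlobal P '' (A.dest (snapshot (φ P) P x)).support).ncard := by
          refine Set.ncard_le_ncard ?_ hfin
          intro q hq
          obtain ⟨i, hi, rfl⟩ := Finset.mem_image.1 (Finset.mem_coe.1 hq)
          have hxi : x i = P := (Finset.mem_filter.1 hi).2
          have := mem_support_independent hy i
          rw [move, PMF.support_map, hxi] at this
          exact this
      _ ≤ _ := Set.ncard_image_le (A.finite_support _)
  · exact Finset.card_image_le.trans (by omega)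

lemma potential_le_sum_add (A : Algorithm) (F : Adversary n) (x₀ : Config n) (T : ℕ) :
    potential x₀ ≤ ∑ t ∈ Finset.range T, expect (A.law F x₀ t) (fun x => A.roundBits (F t x) x) +
      expect (A.law F x₀ T) potential := by
  induction T with
  | zero => simp [law, expect_pure]
  | succ T ih =>
    refine ih.trans ?_
    rw [Finset.sum_range_succ, add_assoc, law, expect_bind, ← expect_add]
    refine add_le_add le_rfl (expect_mono fun x _ => ?_)
    -- The stopped process may spend no bits at a scattered configuration, but there the potential
    -- is already `0`.
    split_ifs with hx
    · rw [potential_eq_zero hx]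
      exact zero_le
    · calc potential x = expect (A.step (F T x) x) fun _ => potential x := (expect_const _ _).symm
        _ ≤ expect (A.step (F T x) x) fun y => A.roundBits (F T x) x + potential y :=
            expect_mono fun y hy => A.potential_le_roundBits_add _ hy
        _ = _ := by rw [expect_add, expect_const]

/-- The potential left after `T` rounds is at most the finite constant `M` times the probability of
not being scattered yet, which tends to `0`. -/
lemma IsScattering.potential_le_expectedBits {A : Algorithm} (hA : A.IsScattering)
    (F : Adversary n) (x₀ : Config n) : potential x₀ ≤ A.expectedBits F x₀ := by
  classical
  set M : ℝ≥0∞ := ENNReal.ofReal (n * Real.logb 2 n) with hM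
  have hbound (T : ℕ) : potential x₀ ≤
      A.expectedBits F x₀ + M * (1 - (A.law F x₀ T).toOuterMeasure {x | Scattered x}) := by
    refine (A.potential_le_sum_add F x₀ T).trans (add_le_add (ENNReal.sum_le_tsum _) ?_)
    calc expect (A.law F x₀ T) potential
        ≤ expect (A.law F x₀ T) fun y => M * if Scattered y then 0 else 1 := by
          refine expect_mono fun y _ => ?_
          split_ifs with h
          · simp [potential_eq_zero h]
          · rw [mul_one]
            exact potential_le y
      _ = _ := by
          have h := toOuterMeasure_scattered_add (A.law F x₀ T)
          rw [expect_mul_left]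
          congr 1
          refine (ENNReal.sub_eq_of_eq_add_rev ?_ h.symm).symm
          exact ((le_self_add.trans_eq h).trans_lt ENNReal.one_lt_top).ne
  have hlim : Filter.Tendsto (fun T => A.expectedBits F x₀ +
      M * (1 - (A.law F x₀ T).toOuterMeasure {x | Scattered x})) Filter.atTop
      (nhds (A.expectedBits F x₀ + M * (1 - 1))) :=
    tendsto_const_nhds.add (ENNReal.Tendsto.const_mul
      (ENNReal.Tendsto.sub tendsto_const_nhds (hA n F x₀) (Or.inl ENNReal.one_ne_top))
      (Or.inr ENNReal.ofReal_ne_top))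
  simpa using ge_of_tendsto' hlim hbound

/-- Every scattering algorithm uses at least `n log₂ n` random bits in the worst case. -/
lemma IsScattering.le_randomBits {A : Algorithm} (hA : A.IsScattering) (n : ℕ) :
    ENNReal.ofReal (n * Real.logb 2 n) ≤ A.randomBits n := by
  rw [← potential_const 0]
  -- The worst case is reached with all robots at the origin and one fixed frame for every robot and
  -- round.
  refine (hA.potential_le_expectedBits (fun _ _ _ => ⟨1, one_pos, .refl ℝ _⟩) _).trans ?_
  exact le_iSup₂ (f := fun (F : Adversary n) x₀ => A.expectedBits F x₀) _ _

end Algorithm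

end Potential

end Scattering

end

theorem mainTheorem10 :
    ∃ K : ℝ≥0, ∀ A : Scattering.Algorithm, A.IsDieudonnePetit ∨ A.IsClement →
      A.IsScattering ∧ A.PreservesScattered ∧
      (∀ n : ℕ, ENNReal.ofReal (n * Real.logb 2 n) ≤ A.randomBits n ∧
        A.randomBits n ≤ K * ENNReal.ofReal (n * Real.logb 2 n)) ∧
      (∀ B : Scattering.Algorithm, B.IsScattering →
        ∀ n : ℕ, A.randomBits n ≤ K * B.randomBits n) := by
  refine ⟨9, fun A hA => ?_⟩
  have hscat : A.IsScattering := hA.elim (fun h => h.isScattering) fun h => h.isScattering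
  have hupper (n : ℕ) :
      A.randomBits n ≤ (9 : ℝ≥0) * ENNReal.ofReal (n * Real.logb 2 n) :=
    hA.elim (fun h => h.randomBits_le n) fun h => h.randomBits_le n
  refine ⟨hscat, hA.elim (fun h => Scattering.Algorithm.IsVoronoi.preservesScattered h)
    fun h => Scattering.Algorithm.IsVoronoi.preservesScattered h,
    fun n => ⟨hscat.le_randomBits n, hupper n⟩, fun B hB n => (hupper n).trans ?_⟩
  gcongr
  exact hB.le_randomBits n
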